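/- Let $Act$ be a set of visible actions, $\tau\notin Act$, $Act_\tau=Act\cup\{\tau\}$. Below $a,b,a_i,b_j\in Act$, $\alpha\in Act_\tau$, $A\subseteq Act$. Let $T(\Sigma_{CLL})$ be the set of recursion-free processes $$t::=0\mid\bot\mid\alpha.t\mid t\,\Box\,t\mid t\wedge t\mid t\vee t\mid t\parallel_A t .$$ **Transitions.** $\to$ is given by the rules: $\alpha.x\xrightarrow{\alpha}x$; $x_1\vee x_2\xrightarrow{\tau}x_k$ $(k=1,2)$; for $\odot\in\{\Box,\wedge,\parallel_A\}$, if $x_1\xrightarrow{\tau}y_1$ then $x_1\odot x_2\xrightarrow{\tau}y_1\odot x_2$, and if $x_2\xrightarrow{\tau}y_2$ then $x_1\odot x_2\xrightarrow{\tau}x_1\odot y_2$; if $x_1\xrightarrow{a}y_1$ and $x_2\not\xrightarrow{\tau}$ then $x_1\Box x_2\xrightarrow{a}y_1$ and, if $a\notin A$, $x_1\parallel_A x_2\xrightarrow{a}y_1\parallel_A x_2$; symmetrically, if $x_1\not\xrightarrow{\tau}$ and $x_2\xrightarrow{a}y_2$ then $x_1\Box x_2\xrightarrow{a}y_2$ and,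 if $a\notin A$, $x_1\parallel_A x_2\xrightarrow{a}x_1\parallel_A y_2$; if $x_1\xrightarrow{a}y_1$ and $x_2\xrightarrow{a}y_2$ then $x_1\wedge x_2\xrightarrow{a}y_1\wedge y_2$ and, if $a\in A$, $x_1\parallel_A x_2\xrightarrow{a}y_1\parallel_A y_2$. A process $p$ is stable if $p\not\xrightarrow{\tau}$; $\mathcal I(p)=\{\alpha\mid p\xrightarrow{\alpha}\}$. **Inconsistency.** $F$ is the least set of processes such that: $\bot\in F$; $x\in F$ implies $\alpha.x\in F$; $x_1,x_2\in F$ implies $x_1\vee x_2\in F$; if $x_1\in F$ or $x_2\in F$ then $x_1\odot x_2\in F$ for $\odot\in\{\Box,\parallel_A,\wedge\}$; and $x_1\wedge x_2\in F$ whenever one of the following holds: (i) $x_1\wedge x_2$ is stable and, for some $a\in Act$, exactly one of $x_1,x_2$ has an $a$-transition; (ii) for some $\alpha$, $x_1\wedge x_2$ has an $\alpha$-transition and all its $\alpha$-successors are in $F$; (iii) every stable process reachable from $x_1\wedge x_2$ by finitely many (possibly zero) $\tau$-transitions is in $F$. **Ready simulation.** $p\stackrel{\epsilon}{\Rightarrow}_F|\,q$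 means that $q$ is stable and reachable from $p$ by finitely many (possibly zero) $\tau$-transitions through processes not in $F$ ($p$ and $q$ included); $p\stackrel{a}{\Rightarrow}_F|\,q$ is defined likewise with exactly one $a$-transition in the sequence, preceded and followed by $\tau$-transitions. A relation $\mathcal R$ is a stable ready simulation if for all $(p,q)\in\mathcal R$: $p$ and $q$ are stable; $p\notin F$ implies $q\notin F$; for every $a\in Act$, if $p\stackrel{a}{\Rightarrow}_F|\,p'$ then $q\stackrel{a}{\Rightarrow}_F|\,q'$ with $(p',q')\in\mathcal R$ for some $q'$; and $p\notin F$ implies $\mathcal I(p)=\mathcal I(q)$. Write $p\sqsubseteq_{RS}q$ if whenever $p\stackrel{\epsilon}{\Rightarrow}_F|\,p'$ there is $q'$ with $q\stackrel{\epsilon}{\Rightarrow}_F|\,q'$ and $(p',q')\in\mathcal R$ for some stable ready simulation $\mathcal R$. **Axioms.** Let $T(\Sigma_B)$ be the set of processes without $\bot$ and without $\wedge$. Finite choices $\Box_{i<n}t_i$ associate to the left; for $n=0$ the choice is $0$ and for $n=1$ it is $t_0$; choices over index sets given by a condition are taken in the order of the indices (lexicographic for pairs). $AX_{CLL}$ is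 the inequational system for $\leq$ on $T(\Sigma_{CLL})$ (an equation $s=t$ stands for $s\leq t$ and $t\leq s$) with reflexivity, transitivity, closure under all operators, and the axioms, for all processes: * $EC$: $x\Box y=y\Box x$; $(x\Box y)\Box z=x\Box(y\Box z)$; ($EC3$) $x\Box x=x$; $x\Box 0=x$; $x\Box\bot=\bot$. * $DI$: $x\vee y=y\vee x$; $x\vee(y\vee z)=(x\vee y)\vee z$; $x\vee x=x$; $x\vee\bot=x$; $x\leq x\vee y$. * $CO$: $x\wedge y=y\wedge x$; $x\wedge x=x$; $x\wedge\bot=\bot$. * $PR$, $PA$: $a.\bot=\bot$; $\tau.x=x$; $x\parallel_A y=y\parallel_A x$; $x\parallel_A\bot=\bot$. * $DS$: $x\odot(y\vee z)\leq(x\odot y)\vee(x\odot z)$ for $\odot\in\{\Box,\wedge,\parallel_A\}$; $a.(x\vee y)\leq a.x\Box a.y$ if $x,y\in T(\Sigma_B)$. * $ECC1$: $\Box_{i<n}a_i.x_i\wedge\Box_{j<m}b_j.y_j=\bot$ if $\{a_i\mid i<n\}\neq\{b_j\mid j<m\}$. * $ECC2$: $\Box_{i<n}a_i.(x_i\wedge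 y_i)\leq\Box_{i<n}a_i.x_i\wedge\Box_{i<n}a_i.y_i$; $ECC3$: the converse inequation if the $a_i$ are pairwise distinct. * $EXP$: with $P=\Box_{i<n}a_i.x_i$, $Q=\Box_{j<m}b_j.y_j$ and $$E=\Big(\Box_{i<n,\,a_i\notin A}\,a_i.(x_i\parallel_A Q)\ \Box\ \Box_{j<m,\,b_j\notin A}\,b_j.(P\parallel_A y_j)\Big)\ \Box\ \Box_{i<n,\,j<m,\,a_i=b_j\in A}\,a_i.(x_i\parallel_A y_j),$$ $P\parallel_A Q\leq E$; and $E\leq P\parallel_A Q$ if all $x_i,y_j\in T(\Sigma_B)$. **Theorem (ground-completeness).** For all $t_1,t_2\in T(\Sigma_{CLL})$, if $t_1\sqsubseteq_{RS}t_2$ then $\vdash t_1\leq t_2$ in $AX_{CLL}$. Moreover, $t_1\leq t_2$ is then already derivable in the subsystem of $AX_{CLL}$ in which $EC3$ is restricted to its instances $a.y\,\Box\,a.y=a.y$ with $a\in Act$. -/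

import Mathlib

namespace CLL

universe u v

/-- The recursion-free processes over the visible actions `Act`. An element of
`Option Act` is an action: `some a` is the visible action `a`, `none` is the invisible action `τ`. -/
inductive Proc (Act : Type u) : Type u
  | nil : Proc Act
  | bot : Proc Act
  | pre : Option Act → Proc Act → Proc Act
  | box : Proc Act → Proc Act → Proc Act
  | conj : Proc Act → Proc Act → Proc Act
  | disj : Proc Act → Proc Act → Proc Act
  | par : Set Act → Proc Act → Proc Act → Proc Act

open Proc

section Semantics

variable {Act : Type u}

/-- The operational rules with a `τ`-labelled conclusion. None of them has a negative premise. -/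
inductive TauStep : Proc Act → Proc Act → Prop
  | pre (x : Proc Act) : TauStep (pre none x) x
  | boxL {x₁ x₂ y₁ : Proc Act} : TauStep x₁ y₁ → TauStep (box x₁ x₂) (box y₁ x₂)
  | boxR {x₁ x₂ y₂ : Proc Act} : TauStep x₂ y₂ → TauStep (box x₁ x₂) (box x₁ y₂)
  | conjL {x₁ x₂ y₁ : Proc Act} : TauStep x₁ y₁ → TauStep (conj x₁ x₂) (conj y₁ x₂)
  | conjR {x₁ x₂ y₂ : Proc Act} : TauStep x₂ y₂ → TauStep (conj x₁ x₂) (conj x₁ y₂)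
  | disjL (x₁ x₂ : Proc Act) : TauStep (disj x₁ x₂) x₁
  | disjR (x₁ x₂ : Proc Act) : TauStep (disj x₁ x₂) x₂
  | parL {A : Set Act} {x₁ x₂ y₁ : Proc Act} :
      TauStep x₁ y₁ → TauStep (par A x₁ x₂) (par A y₁ x₂)
  | parR {A : Set Act} {x₁ x₂ y₂ : Proc Act} :
      TauStep x₂ y₂ → TauStep (par A x₁ x₂) (par A x₁ y₂)

/-- `x` has no outgoing `τ`-transition. -/
def TauFree (x : Proc Act) : Prop := ¬ ∃ y, TauStep x y

/-- The operational rules with a visible label. Their negative premises only concern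
`τ`-transitions, so the rules are stratified by `TauStep`. -/
inductive ActStep : Proc Act → Act → Proc Act → Prop
  | pre (a : Act) (x : Proc Act) : ActStep (pre (some a) x) a x
  | boxL {a : Act} {x₁ x₂ y₁ : Proc Act} :
      ActStep x₁ a y₁ → TauFree x₂ → ActStep (box x₁ x₂) a y₁
  | boxR {a : Act} {x₁ x₂ y₂ : Proc Act} :
      TauFree x₁ → ActStep x₂ a y₂ → ActStep (box x₁ x₂) a y₂
  | conj {a : Act} {x₁ x₂ y₁ y₂ : Proc Act} :
      ActStep x₁ a y₁ → ActStep x₂ a y₂ → ActStep (conj x₁ x₂) a (conj y₁ y₂)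
  | parL {a : Act} {A : Set Act} {x₁ x₂ y₁ : Proc Act} :
      a ∉ A → ActStep x₁ a y₁ → TauFree x₂ → ActStep (par A x₁ x₂) a (par A y₁ x₂)
  | parR {a : Act} {A : Set Act} {x₁ x₂ y₂ : Proc Act} :
      a ∉ A → TauFree x₁ → ActStep x₂ a y₂ → ActStep (par A x₁ x₂) a (par A x₁ y₂)
  | parSync {a : Act} {A : Set Act} {x₁ x₂ y₁ y₂ : Proc Act} :
      a ∈ A → ActStep x₁ a y₁ → ActStep x₂ a y₂ → ActStep (par A x₁ x₂) a (par A y₁ y₂)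

/-- The transition relation `x -α→ y` for an arbitrary action `α`. -/
def Step (x : Proc Act) : Option Act → Proc Act → Prop
  | none, y => TauStep x y
  | some a, y => ActStep x a y

/-- `y` is a stable state reachable from `x` by finitely many (possibly zero) `τ`-transitions. -/
def StableDeriv (x y : Proc Act) : Prop :=
  Relation.ReflTransGen TauStep x y ∧ TauFree y

/-- The inconsistency predicate `F`: the least set of processes closed under the predicate
rules. -/
inductive Incon : Proc Act → Prop
  | bot : Incon bot
  | pre (α : Option Act) {x : Proc Act} : Incon x → Incon (pre α x)
  | disj {x₁ x₂ : Proc Act} : Incon x₁ → Incon x₂ → Incon (disj x₁ x₂)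
  | boxL {x₁ x₂ : Proc Act} : Incon x₁ → Incon (box x₁ x₂)
  | boxR {x₁ x₂ : Proc Act} : Incon x₂ → Incon (box x₁ x₂)
  | parL {A : Set Act} {x₁ x₂ : Proc Act} : Incon x₁ → Incon (par A x₁ x₂)
  | parR {A : Set Act} {x₁ x₂ : Proc Act} : Incon x₂ → Incon (par A x₁ x₂)
  | conjL {x₁ x₂ : Proc Act} : Incon x₁ → Incon (conj x₁ x₂)
  | conjR {x₁ x₂ : Proc Act} : Incon x₂ → Incon (conj x₁ x₂)
  | readyL {a : Act} {x₁ x₂ y₁ : Proc Act} :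
      ActStep x₁ a y₁ → (¬ ∃ y₂, ActStep x₂ a y₂) → TauFree (conj x₁ x₂) →
      Incon (conj x₁ x₂)
  | readyR {a : Act} {x₁ x₂ y₂ : Proc Act} :
      (¬ ∃ y₁, ActStep x₁ a y₁) → ActStep x₂ a y₂ → TauFree (conj x₁ x₂) →
      Incon (conj x₁ x₂)
  | conjStep {α : Option Act} {x₁ x₂ z : Proc Act} :
      Step (conj x₁ x₂) α z → (∀ y, Step (conj x₁ x₂) α y → Incon y) → Incon (conj x₁ x₂)
  | conjStable {x₁ x₂ : Proc Act} :
      (∀ y, StableDeriv (conj x₁ x₂) y → Incon y) → Incon (conj x₁ x₂)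

end Semantics

/-- A labelled transition system over `Act ∪ {τ}` with an inconsistency predicate `F`. -/
structure PLTS (P : Type u) (Act : Type v) where
  tr : P → Option Act → P → Prop
  F : Set P

namespace PLTS

variable {P : Type u} {Act : Type v} (L : PLTS P Act)

def Stable (p : P) : Prop := ¬ ∃ q, L.tr p none q

/-- The ready set of `p`. -/
def ready (p : P) : Set (Option Act) := {α | ∃ q, L.tr p α q}

/-- `p -α→_F q`: a transition between consistent states. -/
def trF (p : P) (α : Option Act) (q : P) : Prop := L.tr p α q ∧ p ∉ L.F ∧ q ∉ L.F

/-- `p =ε⇒_F q`: a sequence of `τ`-transitions all of whose states, `p` and `q` included,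
are consistent. -/
def epsF (p q : P) : Prop :=
  p ∉ L.F ∧ Relation.ReflTransGen (fun x y => L.trF x none y) p q

/-- `p =ε⇒_F| q`. -/
def epsFStable (p q : P) : Prop := L.epsF p q ∧ L.Stable q

/-- `p =α⇒_F| q`. -/
def weakFStable (p : P) (α : Option Act) (q : P) : Prop :=
  (∃ r s, L.epsF p r ∧ L.trF r α s ∧ L.epsF s q) ∧ L.Stable q

/-- `R` is a stable ready simulation relation. -/
structure IsStableReadySim (R : P → P → Prop) : Prop where
  stable : ∀ p q, R p q → L.Stable p ∧ L.Stable q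
  consistent : ∀ p q, R p q → p ∉ L.F → q ∉ L.F
  sim : ∀ p q, R p q → ∀ (a : Act) (p' : P), L.weakFStable p (some a) p' →
    ∃ q', L.weakFStable q (some a) q' ∧ R p' q'
  ready : ∀ p q, R p q → p ∉ L.F → L.ready p = L.ready q

/-- `p` is stable ready simulated by `q`. -/
def StableReadySim (p q : P) : Prop := ∃ R, L.IsStableReadySim R ∧ R p q

/-- `p` is ready simulated by `q`: `p ⊑_RS q`. -/
def ReadySim (p q : P) : Prop :=
  ∀ p', L.epsFStable p p' → ∃ q', L.epsFStable q q' ∧ L.StableReadySim p' q'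

end PLTS

/-- The labelled transition system of the recursion-free processes. -/
def lts (Act : Type u) : PLTS (Proc Act) Act where
  tr := Step
  F := {p | Incon p}

section Axioms

variable {Act : Type u}

/-- The basic process terms `T(Σ_B)`: built without `⊥` and without conjunction. -/
inductive IsBasic : Proc Act → Prop
  | nil : IsBasic nil
  | pre (α : Option Act) {x : Proc Act} : IsBasic x → IsBasic (pre α x)
  | disj {x y : Proc Act} : IsBasic x → IsBasic y → IsBasic (disj x y)
  | box {x y : Proc Act} : IsBasic x → IsBasic y → IsBasic (box x y)
  | par (A : Set Act) {x y : Proc Act} : IsBasic x → IsBasic y → IsBasic (par A x y)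

/-- General external choice `((t₀ □ t₁) □ ⋯) □ tₙ₋₁` of a finite sequence, which is `0` for
the empty sequence and `t₀` for a sequence of length one. -/
def bigBox : List (Proc Act) → Proc Act
  | [] => nil
  | t :: ts => ts.foldl box t

/-- `□_{i<n} aᵢ.xᵢ` for the sequence of pairs `(aᵢ, xᵢ)`. -/
def sumPre (l : List (Act × Proc Act)) : Proc Act :=
  bigBox (l.map fun p => pre (some p.1) p.2)

open Classical in
/-- For `l = (aᵢ, xᵢ)_{i<n}` and `m = (bⱼ, yⱼ)_{j<k}`, the expansion of
`□ aᵢ.xᵢ ∥_A □ bⱼ.yⱼ`. -/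
noncomputable def expansion (A : Set Act) (l m : List (Act × Proc Act)) : Proc Act :=
  box
    (box
      (sumPre ((l.filter fun p => p.1 ∉ A).map fun p => (p.1, par A p.2 (sumPre m))))
      (sumPre ((m.filter fun q => q.1 ∉ A).map fun q => (q.1, par A (sumPre l) q.2))))
    (sumPre (((l ×ˢ m).filter fun r => r.1.1 = r.2.1 ∧ r.1.1 ∈ A).map
      fun r => (r.1.1, par A r.1.2 r.2.2)))

/-- The ground instances of the axioms of `AX_CLL` that are equations. The law `EC3`, that is
`x □ x = x`, is available for `x ∈ S`. -/
inductive EqAx (S : Set (Proc Act)) : Proc Act → Proc Act → Prop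
  | EC1 (x y : Proc Act) : EqAx S (box x y) (box y x)
  | EC2 (x y z : Proc Act) : EqAx S (box (box x y) z) (box x (box y z))
  | EC3 (x : Proc Act) : x ∈ S → EqAx S (box x x) x
  | EC4 (x : Proc Act) : EqAx S (box x nil) x
  | EC5 (x : Proc Act) : EqAx S (box x bot) bot
  | DI1 (x y : Proc Act) : EqAx S (disj x y) (disj y x)
  | DI2 (x y z : Proc Act) : EqAx S (disj x (disj y z)) (disj (disj x y) z)
  | DI3 (x : Proc Act) : EqAx S (disj x x) x
  | DI4 (x : Proc Act) : EqAx S (disj x bot) x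
  | CO1 (x y : Proc Act) : EqAx S (conj x y) (conj y x)
  | CO2 (x : Proc Act) : EqAx S (conj x x) x
  | CO3 (x : Proc Act) : EqAx S (conj x bot) bot
  | PR1 (a : Act) : EqAx S (pre (some a) bot) bot
  | PR2 (x : Proc Act) : EqAx S (pre none x) x
  | PA1 (A : Set Act) (x y : Proc Act) : EqAx S (par A x y) (par A y x)
  | PA2 (A : Set Act) (x : Proc Act) : EqAx S (par A x bot) bot
  | ECC1 (l m : List (Act × Proc Act)) :
      {a | a ∈ l.map Prod.fst} ≠ {b | b ∈ m.map Prod.fst} →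
      EqAx S (conj (sumPre l) (sumPre m)) bot

/-- The ground instances of the axioms of `AX_CLL` that are inequations `s ≤ t`. In `ECC2` and
`ECC3` the list `l` is the sequence of the triples `(aᵢ, xᵢ, yᵢ)`. -/
inductive LeAx : Proc Act → Proc Act → Prop
  | DI5 (x y : Proc Act) : LeAx x (disj x y)
  | DS1 (x y z : Proc Act) : LeAx (box x (disj y z)) (disj (box x y) (box x z))
  | DS2 (x y z : Proc Act) : LeAx (conj x (disj y z)) (disj (conj x y) (conj x z))
  | DS3 (A : Set Act) (x y z : Proc Act) :
      LeAx (par A x (disj y z)) (disj (par A x y) (par A x z))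
  | DS4 (a : Act) {x y : Proc Act} : IsBasic x → IsBasic y →
      LeAx (pre (some a) (disj x y)) (box (pre (some a) x) (pre (some a) y))
  | ECC2 (l : List (Act × Proc Act × Proc Act)) :
      LeAx (sumPre (l.map fun p => (p.1, conj p.2.1 p.2.2)))
        (conj (sumPre (l.map fun p => (p.1, p.2.1))) (sumPre (l.map fun p => (p.1, p.2.2))))
  | ECC3 (l : List (Act × Proc Act × Proc Act)) : (l.map Prod.fst).Nodup →
      LeAx
        (conj (sumPre (l.map fun p => (p.1, p.2.1))) (sumPre (l.map fun p => (p.1, p.2.2))))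
        (sumPre (l.map fun p => (p.1, conj p.2.1 p.2.2)))
  | EXP1 (A : Set Act) (l m : List (Act × Proc Act)) :
      LeAx (par A (sumPre l) (sumPre m)) (expansion A l m)
  | EXP2 (A : Set Act) (l m : List (Act × Proc Act)) :
      (∀ p ∈ l, IsBasic p.2) → (∀ q ∈ m, IsBasic q.2) →
      LeAx (expansion A l m) (par A (sumPre l) (sumPre m))

/-- Derivability of `s ≤ t` in `AX_CLL`, where `EC3` may be used for `x ∈ S` only. -/
inductive DerivWith (S : Set (Proc Act)) : Proc Act → Proc Act → Prop
  | eqLe {s t : Proc Act} : EqAx S s t → DerivWith S s t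
  | eqGe {s t : Proc Act} : EqAx S s t → DerivWith S t s
  | le {s t : Proc Act} : LeAx s t → DerivWith S s t
  | ref (t : Proc Act) : DerivWith S t t
  | trans {s t r : Proc Act} : DerivWith S s t → DerivWith S t r → DerivWith S s r
  | pre (α : Option Act) {s t : Proc Act} : DerivWith S s t → DerivWith S (pre α s) (pre α t)
  | box {s s' t t' : Proc Act} :
      DerivWith S s s' → DerivWith S t t' → DerivWith S (box s t) (box s' t')
  | conj {s s' t t' : Proc Act} :
      DerivWith S s s' → DerivWith S t t' → DerivWith S (conj s t) (conj s' t')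
  | disj {s s' t t' : Proc Act} :
      DerivWith S s s' → DerivWith S t t' → DerivWith S (disj s t) (disj s' t')
  | par (A : Set Act) {s s' t t' : Proc Act} :
      DerivWith S s s' → DerivWith S t t' → DerivWith S (par A s t) (par A s' t')

/-- `⊢ s ≤ t` in `AX_CLL`, with `x □ x = x` for all `x`. -/
def Deriv (s t : Proc Act) : Prop := DerivWith Set.univ s t

/-- `⊢ s ≤ t` in the subsystem of `AX_CLL` in which `x □ x = x` is used only for processes
`x` of the form `a.y` with `a` visible. -/
def DerivPrefixIdem (s t : Proc Act) : Prop :=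
  DerivWith {x | ∃ (a : Act) (y : Proc Act), x = pre (some a) y} s t

end Axioms

end CLL

namespace CLL

universe u

variable {Act : Type u}

open Proc

/-! Work in the ordered set `Cls` of processes modulo provable equality in the subsystem. There the
claim reads `cls t₁ ≤ cls t₂`; the full system inherits it because `DerivWith` is monotone in `S`.
In `Cls`, ∨ is a join with least element ⊥, □ is a commutative monotone addition with zero `nil`,
and □, ∧, ∥ distribute over finite joins. Hence an unstable process is the join of its τ-successors
(`isLUB_tauSucc`).

The core is `reducible`: an inconsistent process equals ⊥, and a stable consistent one equals a sum
of prefixes a.f(a) over its ready set, where f(a) is the join of its a-successors. Such sums merge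
under □ by a.p + a.q = a.(p ⊔ q), under ∧ by the `ECC` laws and under ∥ by expansion. `DS4` and
`EXP2` demand basic arguments, so the same induction also shows that consistent processes are
provably equal to basic ones. Idempotence of □ enters only as a.p + a.p = a.p, which is why the
subsystem suffices.

For a consistent p stably ready simulated by q, the two sums range over the same ready set, so it is
enough to compare coefficients. Each coefficient of p is bounded through the stable consistent
derivatives of its successors, and the simulation matches these by smaller pairs. -/

theorem DerivWith.mono {S T : Set (Proc Act)} (h : S ⊆ T) {s t : Proc Act}
    (d : DerivWith S s t) : DerivWith T s t := by
  have hE : ∀ {s t : Proc Act}, EqAx S s t → EqAx T s t := by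
    intro s t e
    cases e with
    | EC3 _ hx => exact .EC3 _ (h hx)
    | ECC1 l m hlm => exact .ECC1 l m hlm
    | _ => constructor
  induction d with
  | eqLe e => exact .eqLe (hE e)
  | eqGe e => exact .eqGe (hE e)
  | le e => exact .le e
  | ref t => exact .ref t
  | trans _ _ h₁ h₂ => exact h₁.trans h₂
  | pre α _ h₁ => exact .pre α h₁
  | box _ _ h₁ h₂ => exact .box h₁ h₂
  | conj _ _ h₁ h₂ => exact .conj h₁ h₂
  | disj _ _ h₁ h₂ => exact .disj h₁ h₂
  | par A _ _ h₁ h₂ => exact .par A h₁ h₂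

/-! ### Processes modulo provable equality -/

/-- Processes preordered by derivability with `x □ x = x` for prefixes only. -/
instance Proc.instPreorder : Preorder (Proc Act) where
  le s t := DerivPrefixIdem s t
  le_refl t := DerivWith.ref t
  le_trans _ _ _ h₁ h₂ := DerivWith.trans h₁ h₂

/-- Processes modulo provable equality. -/
abbrev Cls (Act : Type u) : Type u := Antisymmetrization (Proc Act) (· ≤ ·)

/-- The class of a process. -/
abbrev cls (t : Proc Act) : Cls Act := toAntisymmetrization (· ≤ ·) t

theorem cls_le {s t : Proc Act} : cls s ≤ cls t ↔ DerivPrefixIdem s t := Iff.rfl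

theorem cls_eq_of_eqAx {s t : Proc Act}
    (h : EqAx {x | ∃ (a : Act) (y : Proc Act), x = pre (some a) y} s t) : cls s = cls t :=
  le_antisymm (cls_le.2 (.eqLe h)) (cls_le.2 (.eqGe h))

theorem cls_le_of_leAx {s t : Proc Act} (h : LeAx s t) : cls s ≤ cls t := cls_le.2 (.le h)

theorem cls_surj (q : Cls Act) : ∃ t, cls t = q := Quotient.exists_rep q

def lift₁ (f : Proc Act → Proc Act) (hf : ∀ ⦃s t⦄, s ≤ t → f s ≤ f t) : Cls Act → Cls Act :=
  Quotient.map f fun _ _ h => ⟨hf h.1, hf h.2⟩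

def lift₂ (f : Proc Act → Proc Act → Proc Act)
    (hf : ∀ ⦃s s' t t'⦄, s ≤ s' → t ≤ t' → f s t ≤ f s' t') : Cls Act → Cls Act → Cls Act :=
  Quotient.map₂ f fun _ _ h _ _ h' => ⟨hf h.1 h'.1, hf h.2 h'.2⟩

namespace Cls

def pre (a : Act) : Cls Act → Cls Act := lift₁ (Proc.pre (some a)) fun _ _ h => .pre _ h

def conj : Cls Act → Cls Act → Cls Act := lift₂ Proc.conj fun _ _ _ _ h h' => .conj h h'

def par (A : Set Act) : Cls Act → Cls Act → Cls Act :=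
  lift₂ (Proc.par A) fun _ _ _ _ h h' => .par A h h'

/-- Minimality of the join is congruence followed by idempotence `DI3`. Associativity of ∨ then
comes for free. -/
instance : SemilatticeSup (Cls Act) where
  sup := lift₂ Proc.disj fun _ _ _ _ h h' => .disj h h'
  le_sup_left p q := by
    obtain ⟨x, rfl⟩ := cls_surj p
    obtain ⟨y, rfl⟩ := cls_surj q
    exact cls_le.2 (.le (.DI5 x y))
  le_sup_right p q := by
    obtain ⟨x, rfl⟩ := cls_surj p
    obtain ⟨y, rfl⟩ := cls_surj q
    exact cls_le.2 (.trans (.le (.DI5 y x)) (.eqLe (.DI1 y x)))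
  sup_le p q r h h' := by
    obtain ⟨x, rfl⟩ := cls_surj p
    obtain ⟨y, rfl⟩ := cls_surj q
    obtain ⟨z, rfl⟩ := cls_surj r
    exact cls_le.2 (.trans (.disj (cls_le.1 h) (cls_le.1 h')) (.eqLe (.DI3 z)))

theorem cls_disj (x y : Proc Act) : cls (disj x y) = cls x ⊔ cls y := rfl

instance : OrderBot (Cls Act) where
  bot := cls bot
  bot_le p := by
    obtain ⟨x, rfl⟩ := cls_surj p
    exact cls_le.2 (.trans (.le (.DI5 bot x)) (.trans (.eqLe (.DI1 bot x)) (.eqLe (.DI4 x))))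

instance : Add (Cls Act) := ⟨lift₂ Proc.box fun _ _ _ _ h h' => .box h h'⟩

instance : Zero (Cls Act) := ⟨cls nil⟩

theorem cls_box (x y : Proc Act) : cls (box x y) = cls x + cls y := rfl

theorem cls_nil : cls (nil : Proc Act) = 0 := rfl

theorem cls_pre (a : Act) (x : Proc Act) : cls (Proc.pre (some a) x) = pre a (cls x) := rfl

theorem cls_conj (x y : Proc Act) : cls (Proc.conj x y) = conj (cls x) (cls y) := rfl

theorem cls_par (A : Set Act) (x y : Proc Act) :
    cls (Proc.par A x y) = par A (cls x) (cls y) := rfl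

theorem cls_tau (x : Proc Act) : cls (Proc.pre none x) = cls x := cls_eq_of_eqAx (.PR2 x)

protected theorem add_comm' (p q : Cls Act) : p + q = q + p := by
  obtain ⟨x, rfl⟩ := cls_surj p
  obtain ⟨y, rfl⟩ := cls_surj q
  exact cls_eq_of_eqAx (.EC1 x y)

protected theorem add_zero' (p : Cls Act) : p + 0 = p := by
  obtain ⟨x, rfl⟩ := cls_surj p
  exact cls_eq_of_eqAx (.EC4 x)

instance : AddCommMonoid (Cls Act) where
  add_assoc p q r := by
    obtain ⟨x, rfl⟩ := cls_surj p
    obtain ⟨y, rfl⟩ := cls_surj q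
    obtain ⟨z, rfl⟩ := cls_surj r
    exact cls_eq_of_eqAx (.EC2 x y z)
  zero_add p := by rw [Cls.add_comm', Cls.add_zero']
  add_zero := Cls.add_zero'
  add_comm := Cls.add_comm'
  nsmul := nsmulRec

protected theorem add_le_add' {p p' q q' : Cls Act} (h : p ≤ p') (h' : q ≤ q') :
    p + q ≤ p' + q' := by
  obtain ⟨x, rfl⟩ := cls_surj p
  obtain ⟨y, rfl⟩ := cls_surj q
  obtain ⟨x', rfl⟩ := cls_surj p'
  obtain ⟨y', rfl⟩ := cls_surj q'
  exact cls_le.2 (.box (cls_le.1 h) (cls_le.1 h'))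

instance : IsOrderedAddMonoid (Cls Act) where
  add_le_add_left _ _ h _ := Cls.add_le_add' h le_rfl

theorem pre_mono (a : Act) : Monotone (pre a) := by
  intro p q h
  obtain ⟨x, rfl⟩ := cls_surj p
  obtain ⟨y, rfl⟩ := cls_surj q
  exact cls_le.2 (.pre _ (cls_le.1 h))

theorem pre_bot (a : Act) : pre a ⊥ = ⊥ := cls_eq_of_eqAx (.PR1 a)

/-- The only appeal to `EC3`, and it is an instance at a visible prefix. -/
theorem pre_add_self (a : Act) (p : Cls Act) : pre a p + pre a p = pre a p := by
  obtain ⟨x, rfl⟩ := cls_surj p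
  exact cls_eq_of_eqAx (.EC3 _ ⟨a, x, rfl⟩)

theorem add_bot (p : Cls Act) : p + ⊥ = ⊥ := by
  obtain ⟨x, rfl⟩ := cls_surj p
  exact cls_eq_of_eqAx (.EC5 x)

theorem bot_add (p : Cls Act) : ⊥ + p = ⊥ := by rw [add_comm, add_bot]

/-- A commutative monotone operation that distributes over finite joins. -/
structure JoinOp (op : Cls Act → Cls Act → Cls Act) : Prop where
  comm : ∀ p q, op p q = op q p
  mono : ∀ {p p' q q'}, p ≤ p' → q ≤ q' → op p q ≤ op p' q'
  bot : ∀ p, op p ⊥ = ⊥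
  sup_le : ∀ p q r, op p (q ⊔ r) ≤ op p q ⊔ op p r

theorem joinOp_add : JoinOp (Act := Act) (· + ·) where
  comm := add_comm
  mono := Cls.add_le_add'
  bot := add_bot
  sup_le p q r := by
    obtain ⟨x, rfl⟩ := cls_surj p
    obtain ⟨y, rfl⟩ := cls_surj q
    obtain ⟨z, rfl⟩ := cls_surj r
    exact cls_le_of_leAx (.DS1 x y z)

theorem joinOp_conj : JoinOp (Act := Act) conj where
  comm p q := by
    obtain ⟨x, rfl⟩ := cls_surj p
    obtain ⟨y, rfl⟩ := cls_surj q
    exact cls_eq_of_eqAx (.CO1 x y)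
  mono := by
    intro p p' q q' h h'
    obtain ⟨x, rfl⟩ := cls_surj p
    obtain ⟨y, rfl⟩ := cls_surj q
    obtain ⟨x', rfl⟩ := cls_surj p'
    obtain ⟨y', rfl⟩ := cls_surj q'
    exact cls_le.2 (.conj (cls_le.1 h) (cls_le.1 h'))
  bot p := by
    obtain ⟨x, rfl⟩ := cls_surj p
    exact cls_eq_of_eqAx (.CO3 x)
  sup_le p q r := by
    obtain ⟨x, rfl⟩ := cls_surj p
    obtain ⟨y, rfl⟩ := cls_surj q
    obtain ⟨z, rfl⟩ := cls_surj r
    exact cls_le_of_leAx (.DS2 x y z)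

theorem joinOp_par (A : Set Act) : JoinOp (par A) where
  comm p q := by
    obtain ⟨x, rfl⟩ := cls_surj p
    obtain ⟨y, rfl⟩ := cls_surj q
    exact cls_eq_of_eqAx (.PA1 A x y)
  mono := by
    intro p p' q q' h h'
    obtain ⟨x, rfl⟩ := cls_surj p
    obtain ⟨y, rfl⟩ := cls_surj q
    obtain ⟨x', rfl⟩ := cls_surj p'
    obtain ⟨y', rfl⟩ := cls_surj q'
    exact cls_le.2 (.par A (cls_le.1 h) (cls_le.1 h'))
  bot p := by
    obtain ⟨x, rfl⟩ := cls_surj p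
    exact cls_eq_of_eqAx (.PA2 A x)
  sup_le p q r := by
    obtain ⟨x, rfl⟩ := cls_surj p
    obtain ⟨y, rfl⟩ := cls_surj q
    obtain ⟨z, rfl⟩ := cls_surj r
    exact cls_le_of_leAx (.DS3 A x y z)

namespace JoinOp

variable {op : Cls Act → Cls Act → Cls Act}

theorem bot_left (h : JoinOp op) (p : Cls Act) : op ⊥ p = ⊥ := by rw [h.comm, h.bot]

/-- Binary distributivity extends to all finite joins; the empty one is covered by `op p ⊥ = ⊥`. -/
theorem le_of_isLUB (h : JoinOp op) {X : Set (Cls Act)} (hX : X.Finite) {q : Cls Act}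
    (hq : IsLUB X q) {p u : Cls Act} (hu : ∀ x ∈ X, op p x ≤ u) : op p q ≤ u := by
  lift X to Finset (Cls Act) using hX
  have key : ∀ s : Finset (Cls Act), (∀ x ∈ s, op p x ≤ u) → op p (s.sup id) ≤ u := by
    classical
    intro s
    induction s using Finset.induction with
    | empty => intro _; rw [Finset.sup_empty, h.bot]; exact bot_le
    | insert a s _ ih =>
      intro hs
      rw [Finset.sup_insert]
      exact (h.sup_le _ _ _).trans (_root_.sup_le (hs a (by simp)) (ih fun x hx => hs x (by simp [hx])))
  exact (h.mono le_rfl (hq.2 fun x hx => Finset.le_sup (f := id) hx)).trans (key X hu)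

theorem isLUB_image2 (h : JoinOp op) {X Y : Set (Cls Act)} (hX : X.Finite) (hY : Y.Finite)
    {p q : Cls Act} (hp : IsLUB X p) (hq : IsLUB Y q) :
    IsLUB (Set.image2 op X Y) (op p q) := by
  refine ⟨?_, fun u hu => h.le_of_isLUB hY hq fun y hy => ?_⟩
  · rintro _ ⟨x, hx, y, hy, rfl⟩
    exact h.mono (hp.1 hx) (hq.1 hy)
  · rw [h.comm]
    refine h.le_of_isLUB hX hp fun x hx => ?_
    rw [h.comm]
    exact hu ⟨x, hx, y, hy, rfl⟩

end JoinOp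

/-! ### Basic classes and prefix sums -/

/-- The class contains a basic process. -/
def IsB (q : Cls Act) : Prop := ∃ b, IsBasic b ∧ cls b = q

theorem IsB.sup {p q : Cls Act} : IsB p → IsB q → IsB (p ⊔ q) := by
  rintro ⟨x, hx, rfl⟩ ⟨y, hy, rfl⟩
  exact ⟨_, .disj hx hy, rfl⟩

theorem IsB.add {p q : Cls Act} : IsB p → IsB q → IsB (p + q) := by
  rintro ⟨x, hx, rfl⟩ ⟨y, hy, rfl⟩
  exact ⟨_, .box hx hy, rfl⟩

theorem IsB.par (A : Set Act) {p q : Cls Act} : IsB p → IsB q → IsB (Cls.par A p q) := by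
  rintro ⟨x, hx, rfl⟩ ⟨y, hy, rfl⟩
  exact ⟨_, .par A hx hy, rfl⟩

theorem IsB.pre (a : Act) {p : Cls Act} : IsB p → IsB (Cls.pre a p) := by
  rintro ⟨x, hx, rfl⟩
  exact ⟨_, .pre (some a) hx, rfl⟩

theorem isB_zero : IsB (0 : Cls Act) := ⟨nil, .nil, rfl⟩

theorem isB_sum {ι : Type*} (s : Finset ι) (f : ι → Cls Act) (h : ∀ i ∈ s, IsB (f i)) :
    IsB (∑ i ∈ s, f i) :=
  Finset.sum_induction f IsB (fun _ _ => IsB.add) isB_zero h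

/-- Members equal to ⊥ drop out of the join, and the remaining basic ones are closed under ⊔. -/
theorem isB_of_isLUB {X : Set (Cls Act)} (hX : X.Finite) (h : ∀ x ∈ X, x = ⊥ ∨ IsB x)
    (hne : ∃ x ∈ X, IsB x) {q : Cls Act} (hq : IsLUB X q) : IsB q := by
  lift X to Finset (Cls Act) using hX
  have hq' : q = X.sup id := hq.unique (by simpa using Finset.isLUB_sup (s := X) (f := id))
  have key : X.sup id = ⊥ ∨ IsB (X.sup id) := by
    refine Finset.sup_induction (p := fun x => x = ⊥ ∨ IsB x) (Or.inl rfl) ?_ (by simpa using h)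
    rintro a (rfl | ha) b (rfl | hb)
    · simp
    · simpa using Or.inr hb
    · simpa using Or.inr ha
    · exact Or.inr (ha.sup hb)
  rcases key with h0 | h0
  · obtain ⟨x, hx, hb⟩ := hne
    -- If the join is ⊥, its basic member lies below ⊥ and so equals it. No proof that ⊥ fails to be
    -- basic is needed.
    have : x = q := le_antisymm (hq.1 hx) (by rw [hq', h0]; exact bot_le)
    exact this ▸ hb
  · exact hq' ▸ h0

/-! ### Merging, conjoining and expanding prefix sums -/

/-- One direction enlarges both summands to a.(p ⊔ q) and contracts them by idempotence; the other
is `DS4`, which forces the restriction to basic classes. -/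
theorem pre_add_pre (a : Act) {p q : Cls Act} (hp : IsB p) (hq : IsB q) :
    pre a p + pre a q = pre a (p ⊔ q) := by
  refine le_antisymm ?_ ?_
  · rw [← pre_add_self a (p ⊔ q)]
    exact add_le_add (pre_mono a le_sup_left) (pre_mono a le_sup_right)
  · obtain ⟨x, hx, rfl⟩ := hp
    obtain ⟨y, hy, rfl⟩ := hq
    exact cls_le_of_leAx (.DS4 a hx hy)

open Classical in
theorem sum_pre_add_sum_pre {S T : Finset Act} {f g : Act → Cls Act}
    (hf : ∀ a ∈ S, IsB (f a)) (hf0 : ∀ a ∉ S, f a = ⊥)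
    (hg : ∀ a ∈ T, IsB (g a)) (hg0 : ∀ a ∉ T, g a = ⊥) :
    ∑ a ∈ S, pre a (f a) + ∑ a ∈ T, pre a (g a) = ∑ a ∈ S ∪ T, pre a (f a ⊔ g a) := by
  -- Missing summands are padded with 0, not with `pre a ⊥`: the latter is ⊥ and would absorb the
  -- whole sum.
  have h₁ : ∑ a ∈ S, pre a (f a) = ∑ a ∈ S ∪ T, if a ∈ S then pre a (f a) else 0 := by
    rw [← Finset.sum_filter]
    exact Finset.sum_congr (by ext; simp +contextual) fun _ _ => rfl
  have h₂ : ∑ a ∈ T, pre a (g a) = ∑ a ∈ S ∪ T, if a ∈ T then pre a (g a) else 0 := by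
    rw [← Finset.sum_filter]
    exact Finset.sum_congr (by ext; simp +contextual) fun _ _ => rfl
  rw [h₁, h₂, ← Finset.sum_add_distrib]
  refine Finset.sum_congr rfl fun a ha => ?_
  by_cases hS : a ∈ S <;> by_cases hT : a ∈ T
  · simp [hS, hT, pre_add_pre a (hf a hS) (hg a hT)]
  · simp [hS, hT, hg0 a hT]
  · simp [hS, hT, hf0 a hS]
  · simp [hS, hT] at ha

theorem cls_bigBox (l : List (Proc Act)) : cls (bigBox l) = (l.map cls).sum := by
  have key : ∀ (l : List (Proc Act)) (t : Proc Act),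
      cls (l.foldl box t) = cls t + (l.map cls).sum := by
    intro l
    induction l with
    | nil => intro t; simp
    | cons x l ih => intro t; simp [ih, cls_box, add_assoc]
  cases l with
  | nil => rfl
  | cons x l => simpa [bigBox] using key l x

theorem cls_sumPre (l : List (Act × Proc Act)) :
    cls (sumPre l) = (l.map fun p => pre p.1 (cls p.2)).sum := by
  rw [sumPre, cls_bigBox, List.map_map]
  rfl

theorem cls_sumPre_map {ι : Type*} [DecidableEq ι] {l : List ι} (hl : l.Nodup)
    (h : ι → Act × Proc Act) :
    cls (sumPre (l.map h)) = ∑ i ∈ l.toFinset, pre (h i).1 (cls (h i).2) := by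
  rw [cls_sumPre, List.map_map, List.sum_toFinset _ hl]
  rfl

theorem cls_sumPre_toList (S : Finset Act) (r : Act → Proc Act) :
    cls (sumPre (S.toList.map fun a => (a, r a))) = ∑ a ∈ S, pre a (cls (r a)) := by
  classical
  rw [cls_sumPre_map S.nodup_toList, Finset.toList_toFinset]

theorem exists_rep (f : Act → Cls Act) : ∃ r : Act → Proc Act, f = fun a => cls (r a) := by
  choose r hr using fun a => cls_surj (f a)
  exact ⟨r, funext fun a => (hr a).symm⟩

theorem conj_sum_pre_of_ne {S T : Finset Act} (h : S ≠ T) (f g : Act → Cls Act) :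
    conj (∑ a ∈ S, pre a (f a)) (∑ a ∈ T, pre a (g a)) = ⊥ := by
  obtain ⟨r, rfl⟩ := exists_rep f
  obtain ⟨s, rfl⟩ := exists_rep g
  rw [← cls_sumPre_toList, ← cls_sumPre_toList, ← cls_conj]
  refine cls_eq_of_eqAx (.ECC1 _ _ fun h' => h (Finset.ext fun a => ?_))
  simpa using Set.ext_iff.1 h' a

/-- Indexing by a `Finset` supplies the distinct actions required by `ECC3`. -/
theorem conj_sum_pre (S : Finset Act) (f g : Act → Cls Act) :
    conj (∑ a ∈ S, pre a (f a)) (∑ a ∈ S, pre a (g a)) = ∑ a ∈ S, pre a (conj (f a) (g a)) := by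
  obtain ⟨r, rfl⟩ := exists_rep f
  obtain ⟨s, rfl⟩ := exists_rep g
  have h₁ := cls_le_of_leAx (.ECC2 (S.toList.map fun a => (a, r a, s a)))
  have h₂ := cls_le_of_leAx (.ECC3 (S.toList.map fun a => (a, r a, s a))
    (by simpa [Function.comp_def] using S.nodup_toList))
  simp only [List.map_map, Function.comp_def, cls_conj] at h₁ h₂
  rw [cls_sumPre_toList S r, cls_sumPre_toList S s,
    cls_sumPre_toList S fun a => Proc.conj (r a) (s a)] at h₁ h₂
  exact le_antisymm h₂ h₁

open Classical in
theorem par_sum_pre (A : Set Act) {S T : Finset Act} {f g : Act → Cls Act}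
    (hf : ∀ a ∈ S, IsB (f a)) (hg : ∀ a ∈ T, IsB (g a)) :
    par A (∑ a ∈ S, pre a (f a)) (∑ a ∈ T, pre a (g a)) =
      ∑ a ∈ S with a ∉ A, pre a (par A (f a) (∑ b ∈ T, pre b (g b))) +
      ∑ b ∈ T with b ∉ A, pre b (par A (∑ a ∈ S, pre a (f a)) (g b)) +
      ∑ a ∈ S ∩ T with a ∈ A, pre a (par A (f a) (g a)) := by
  -- `EXP2` speaks of processes, so basic representatives of the coefficients are chosen.
  have rep : ∀ (U : Finset Act) (k : Act → Cls Act), (∀ a ∈ U, IsB (k a)) →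
      ∃ r : Act → Proc Act, ∀ a ∈ U, IsBasic (r a) ∧ cls (r a) = k a := by
    intro U k hk
    have : Nonempty (Proc Act) := ⟨nil⟩
    choose! r hr using hk
    exact ⟨r, hr⟩
  obtain ⟨r, hr⟩ := rep S f hf
  obtain ⟨s, hs⟩ := rep T g hg
  set l := S.toList.map fun a => (a, r a) with hl
  set m := T.toList.map fun a => (a, s a) with hm
  have nl : l.Nodup := S.nodup_toList.map fun a b h => (Prod.ext_iff.1 h).1
  have nm : m.Nodup := T.nodup_toList.map fun a b h => (Prod.ext_iff.1 h).1
  have el : cls (sumPre l) = ∑ a ∈ S, pre a (f a) := by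
    rw [hl, cls_sumPre_toList]
    exact Finset.sum_congr rfl fun a ha => by rw [(hr a ha).2]
  have em : cls (sumPre m) = ∑ a ∈ T, pre a (g a) := by
    rw [hm, cls_sumPre_toList]
    exact Finset.sum_congr rfl fun a ha => by rw [(hs a ha).2]
  have hexp : cls (Proc.par A (sumPre l) (sumPre m)) = cls (expansion A l m) := by
    refine le_antisymm (cls_le_of_leAx (.EXP1 A l m)) (cls_le_of_leAx (.EXP2 A l m ?_ ?_))
    · intro p hp
      obtain ⟨a, ha, rfl⟩ := List.mem_map.1 hp
      exact (hr a (by simpa using ha)).1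
    · intro p hp
      obtain ⟨a, ha, rfl⟩ := List.mem_map.1 hp
      exact (hs a (by simpa using ha)).1
  rw [cls_par, el, em] at hexp
  rw [hexp, expansion, cls_box, cls_box, cls_sumPre_map (nl.filter _), cls_sumPre_map (nm.filter _),
    cls_sumPre_map ((nl.product nm).filter _)]
  congr 1
  · congr 1
    · refine Finset.sum_nbij' (fun p => p.1) (fun a => (a, r a)) ?_ ?_ ?_ ?_ ?_
      · simp +contextual [hl]
      · simp +contextual [hl]
      · simp +contextual [hl]
      · simp
      · simp +contextual [hl, cls_par, em, hr]
    · refine Finset.sum_nbij' (fun p => p.1) (fun a => (a, s a)) ?_ ?_ ?_ ?_ ?_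
      · simp +contextual [hm]
      · simp +contextual [hm]
      · simp +contextual [hm]
      · simp
      · simp +contextual [hm, cls_par, el, hs]
  -- Each action heads at most one entry of `l` and of `m`, so synchronising pairs correspond to
  -- actions of S ∩ T in A.
  · refine Finset.sum_nbij' (fun p => p.1.1) (fun a => ((a, r a), (a, s a))) ?_ ?_ ?_ ?_ ?_
    · rintro ⟨⟨a, x⟩, ⟨b, y⟩⟩
      simp only [hl, hm, List.toFinset_filter, Finset.mem_filter, List.mem_toFinset,
        List.mem_product, List.mem_map, Finset.mem_toList, decide_eq_true_eq]
      grind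
    · simp +contextual [hl, hm]
    · rintro ⟨⟨a, x⟩, ⟨b, y⟩⟩
      simp only [hl, hm, List.toFinset_filter, Finset.mem_filter, List.mem_toFinset,
        List.mem_product, List.mem_map, Finset.mem_toList, decide_eq_true_eq]
      grind
    · simp
    · rintro ⟨⟨a, x⟩, ⟨b, y⟩⟩
      simp only [List.toFinset_filter, Finset.mem_filter, List.mem_toFinset, List.mem_product, hl,
        hm, List.mem_map, Finset.mem_toList, decide_eq_true_eq]
      rintro ⟨⟨⟨a', ha, h₁⟩, ⟨b', hb, h₂⟩⟩, h₃, -⟩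
      cases h₁
      cases h₂
      cases h₃
      rw [cls_par, (hr _ ha).2, (hs _ hb).2]

end Cls

/-! ### Transitions -/

/-- Without recursion every transition shrinks the process. This measure drives the inductions that
follow transitions, whose targets need not be subterms. -/
def size : Proc Act → ℕ
  | nil => 1
  | bot => 1
  | pre _ x => size x + 1
  | box x y => size x + size y + 1
  | conj x y => size x + size y + 1
  | disj x y => size x + size y + 1
  | par _ x y => size x + size y + 1

theorem TauStep.size_lt {x y : Proc Act} (h : TauStep x y) : size y < size x := by
  induction h <;> simp only [size] <;> omega

theorem ActStep.size_lt {x y : Proc Act} {a : Act} (h : ActStep x a y) : size y < size x := by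
  induction h <;> simp only [size] <;> omega

theorem size_le_of_reflTransGen {x y : Proc Act} (h : Relation.ReflTransGen TauStep x y) :
    size y ≤ size x := by
  induction h with
  | refl => rfl
  | tail _ h ih => exact h.size_lt.le.trans ih

theorem tauFree_nil : TauFree (nil : Proc Act) := by rintro ⟨_, ⟨⟩⟩

theorem tauFree_pre (a : Act) (x : Proc Act) : TauFree (pre (some a) x) := by rintro ⟨_, ⟨⟩⟩

theorem not_tauFree_tau (x : Proc Act) : ¬ TauFree (pre none x) := fun h => h ⟨_, .pre x⟩

theorem not_tauFree_disj (x y : Proc Act) : ¬ TauFree (disj x y) := fun h => h ⟨_, .disjL x y⟩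

theorem tauFree_box {x y : Proc Act} : TauFree (box x y) ↔ TauFree x ∧ TauFree y := by
  refine ⟨fun h => ⟨?_, ?_⟩, ?_⟩
  · rintro ⟨z, hz⟩; exact h ⟨_, .boxL hz⟩
  · rintro ⟨z, hz⟩; exact h ⟨_, .boxR hz⟩
  · rintro ⟨hx, hy⟩ ⟨_, hz | hz⟩
    exacts [hx ⟨_, ‹_›⟩, hy ⟨_, ‹_›⟩]

theorem tauFree_conj {x y : Proc Act} : TauFree (conj x y) ↔ TauFree x ∧ TauFree y := by
  refine ⟨fun h => ⟨?_, ?_⟩, ?_⟩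
  · rintro ⟨z, hz⟩; exact h ⟨_, .conjL hz⟩
  · rintro ⟨z, hz⟩; exact h ⟨_, .conjR hz⟩
  · rintro ⟨hx, hy⟩ ⟨_, hz | hz⟩
    exacts [hx ⟨_, ‹_›⟩, hy ⟨_, ‹_›⟩]

theorem tauFree_par {A : Set Act} {x y : Proc Act} :
    TauFree (par A x y) ↔ TauFree x ∧ TauFree y := by
  refine ⟨fun h => ⟨?_, ?_⟩, ?_⟩
  · rintro ⟨z, hz⟩; exact h ⟨_, .parL hz⟩
  · rintro ⟨z, hz⟩; exact h ⟨_, .parR hz⟩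
  · rintro ⟨hx, hy⟩ ⟨_, hz | hz⟩
    exacts [hx ⟨_, ‹_›⟩, hy ⟨_, ‹_›⟩]

theorem ActStep.tauFree {x y : Proc Act} {a : Act} (h : ActStep x a y) : TauFree x := by
  induction h with
  | pre a x => exact tauFree_pre a x
  | boxL _ h ih => exact tauFree_box.2 ⟨ih, h⟩
  | boxR h _ ih => exact tauFree_box.2 ⟨h, ih⟩
  | conj _ _ h₁ h₂ => exact tauFree_conj.2 ⟨h₁, h₂⟩
  | parL _ _ h ih => exact tauFree_par.2 ⟨ih, h⟩
  | parR _ h _ ih => exact tauFree_par.2 ⟨h, ih⟩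
  | parSync _ _ _ h₁ h₂ => exact tauFree_par.2 ⟨h₁, h₂⟩

/-- The classes of the `τ`-successors. -/
def tauSucc (t : Proc Act) : Set (Cls Act) := cls '' {y | TauStep t y}

/-- The classes of the `a`-successors. -/
def actSucc (t : Proc Act) (a : Act) : Set (Cls Act) := cls '' {y | ActStep t a y}

theorem TauStep.mem_tauSucc {x y : Proc Act} (h : TauStep x y) : cls y ∈ tauSucc x := ⟨y, h, rfl⟩

theorem ActStep.mem_actSucc {x y : Proc Act} {a : Act} (h : ActStep x a y) :
    cls y ∈ actSucc x a := ⟨y, h, rfl⟩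

theorem tauSucc_nonempty {t : Proc Act} : (tauSucc t).Nonempty ↔ ¬ TauFree t := by
  simp [tauSucc, TauFree, Set.Nonempty]

theorem tauSucc_tau (x : Proc Act) : tauSucc (pre none x) = {cls x} := by
  ext q
  constructor
  · rintro ⟨_, ⟨⟩, rfl⟩; rfl
  · rintro rfl; exact (TauStep.pre x).mem_tauSucc

theorem tauSucc_disj (x y : Proc Act) : tauSucc (disj x y) = {cls x, cls y} := by
  ext q
  constructor
  · rintro ⟨_, ⟨⟩, rfl⟩ <;> simp
  · rintro (rfl | rfl)
    exacts [(TauStep.disjL x y).mem_tauSucc, (TauStep.disjR x y).mem_tauSucc]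

theorem tauSucc_box (x y : Proc Act) : tauSucc (box x y) =
    (fun q => q + cls y) '' tauSucc x ∪ (fun q => cls x + q) '' tauSucc y := by
  ext q
  constructor
  · rintro ⟨_, h | h, rfl⟩
    exacts [Or.inl ⟨_, ⟨_, ‹_›, rfl⟩, rfl⟩, Or.inr ⟨_, ⟨_, ‹_›, rfl⟩, rfl⟩]
  · rintro (⟨_, ⟨z, hz, rfl⟩, rfl⟩ | ⟨_, ⟨z, hz, rfl⟩, rfl⟩)
    exacts [(TauStep.boxL hz).mem_tauSucc, (TauStep.boxR hz).mem_tauSucc]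

theorem tauSucc_conj (x y : Proc Act) : tauSucc (conj x y) =
    (fun q => Cls.conj q (cls y)) '' tauSucc x ∪ (fun q => Cls.conj (cls x) q) '' tauSucc y := by
  ext q
  constructor
  · rintro ⟨_, h | h, rfl⟩
    exacts [Or.inl ⟨_, ⟨_, ‹_›, rfl⟩, rfl⟩, Or.inr ⟨_, ⟨_, ‹_›, rfl⟩, rfl⟩]
  · rintro (⟨_, ⟨z, hz, rfl⟩, rfl⟩ | ⟨_, ⟨z, hz, rfl⟩, rfl⟩)
    exacts [(TauStep.conjL hz).mem_tauSucc, (TauStep.conjR hz).mem_tauSucc]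

theorem tauSucc_par (A : Set Act) (x y : Proc Act) : tauSucc (par A x y) =
    (fun q => Cls.par A q (cls y)) '' tauSucc x ∪
      (fun q => Cls.par A (cls x) q) '' tauSucc y := by
  ext q
  constructor
  · rintro ⟨_, h | h, rfl⟩
    exacts [Or.inl ⟨_, ⟨_, ‹_›, rfl⟩, rfl⟩, Or.inr ⟨_, ⟨_, ‹_›, rfl⟩, rfl⟩]
  · rintro (⟨_, ⟨z, hz, rfl⟩, rfl⟩ | ⟨_, ⟨z, hz, rfl⟩, rfl⟩)
    exacts [(TauStep.parL hz).mem_tauSucc, (TauStep.parR hz).mem_tauSucc]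

theorem finite_tauSucc (t : Proc Act) : (tauSucc t).Finite := by
  induction t with
  | nil => exact Set.finite_empty.subset (by rintro _ ⟨_, ⟨⟩, _⟩)
  | bot => exact Set.finite_empty.subset (by rintro _ ⟨_, ⟨⟩, _⟩)
  | pre α x _ =>
    cases α with
    | none => rw [tauSucc_tau]; exact Set.finite_singleton _
    | some a => exact Set.finite_empty.subset (by rintro _ ⟨_, ⟨⟩, _⟩)
  | disj x y _ _ => rw [tauSucc_disj]; exact Set.toFinite _
  | box x y hx hy => rw [tauSucc_box]; exact (hx.image _).union (hy.image _)
  | conj x y hx hy => rw [tauSucc_conj]; exact (hx.image _).union (hy.image _)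
  | par A x y hx hy => rw [tauSucc_par]; exact (hx.image _).union (hy.image _)

theorem actSucc_nil (a : Act) : actSucc nil a = ∅ := by
  rw [actSucc, Set.image_eq_empty, Set.eq_empty_iff_forall_notMem]
  rintro _ ⟨⟩

theorem actSucc_pre_self (a : Act) (x : Proc Act) : actSucc (pre (some a) x) a = {cls x} := by
  ext q
  constructor
  · rintro ⟨_, ⟨⟩, rfl⟩; rfl
  · rintro rfl; exact (ActStep.pre a x).mem_actSucc

theorem actSucc_pre_of_ne {a b : Act} (h : b ≠ a) (x : Proc Act) :
    actSucc (pre (some a) x) b = ∅ := by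
  rw [actSucc, Set.image_eq_empty, Set.eq_empty_iff_forall_notMem]
  rintro _ ⟨⟩
  exact h rfl

theorem actSucc_box_subset (x y : Proc Act) (a : Act) :
    actSucc (box x y) a ⊆ actSucc x a ∪ actSucc y a := by
  rintro _ ⟨_, h | h, rfl⟩
  exacts [Or.inl ⟨_, ‹_›, rfl⟩, Or.inr ⟨_, ‹_›, rfl⟩]

theorem actSucc_box {x y : Proc Act} (h : TauFree (box x y)) (a : Act) :
    actSucc (box x y) a = actSucc x a ∪ actSucc y a := by
  obtain ⟨hx, hy⟩ := tauFree_box.1 h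
  refine (actSucc_box_subset x y a).antisymm ?_
  rintro _ (⟨z, hz, rfl⟩ | ⟨z, hz, rfl⟩)
  exacts [(ActStep.boxL hz hy).mem_actSucc, (ActStep.boxR hx hz).mem_actSucc]

theorem actSucc_conj (x y : Proc Act) (a : Act) :
    actSucc (conj x y) a = Set.image2 Cls.conj (actSucc x a) (actSucc y a) := by
  ext q
  constructor
  · rintro ⟨_, h, rfl⟩
    cases h with
    | conj h₁ h₂ => exact ⟨_, h₁.mem_actSucc, _, h₂.mem_actSucc, rfl⟩
  · rintro ⟨_, ⟨z, hz, rfl⟩, _, ⟨w, hw, rfl⟩, rfl⟩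
    exact (ActStep.conj hz hw).mem_actSucc

theorem actSucc_par_of_mem {A : Set Act} {a : Act} (ha : a ∈ A) (x y : Proc Act) :
    actSucc (par A x y) a = Set.image2 (Cls.par A) (actSucc x a) (actSucc y a) := by
  ext q
  constructor
  · rintro ⟨_, h, rfl⟩
    cases h with
    | parSync _ h₁ h₂ => exact ⟨_, h₁.mem_actSucc, _, h₂.mem_actSucc, rfl⟩
    | parL h => exact absurd ha h
    | parR h => exact absurd ha h
  · rintro ⟨_, ⟨z, hz, rfl⟩, _, ⟨w, hw, rfl⟩, rfl⟩
    exact (ActStep.parSync ha hz hw).mem_actSucc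

theorem actSucc_par_subset {A : Set Act} {a : Act} (ha : a ∉ A) (x y : Proc Act) :
    actSucc (par A x y) a ⊆ Set.image2 (Cls.par A) (actSucc x a) {cls y} ∪
      Set.image2 (Cls.par A) {cls x} (actSucc y a) := by
  rintro _ ⟨_, h, rfl⟩
  cases h with
  | parSync h => exact absurd h ha
  | parL _ h => exact Or.inl ⟨_, h.mem_actSucc, _, rfl, rfl⟩
  | parR _ _ h => exact Or.inr ⟨_, rfl, _, h.mem_actSucc, rfl⟩

theorem actSucc_par_of_notMem {A : Set Act} {a : Act} (ha : a ∉ A) {x y : Proc Act}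
    (h : TauFree (par A x y)) :
    actSucc (par A x y) a = Set.image2 (Cls.par A) (actSucc x a) {cls y} ∪
      Set.image2 (Cls.par A) {cls x} (actSucc y a) := by
  obtain ⟨hx, hy⟩ := tauFree_par.1 h
  refine (actSucc_par_subset ha x y).antisymm ?_
  rintro _ (⟨_, ⟨z, hz, rfl⟩, _, rfl, rfl⟩ | ⟨_, rfl, _, ⟨z, hz, rfl⟩, rfl⟩)
  exacts [(ActStep.parL ha hz hy).mem_actSucc, (ActStep.parR ha hx hz).mem_actSucc]

theorem finite_actSucc (t : Proc Act) (a : Act) : (actSucc t a).Finite := by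
  induction t with
  | nil => exact Set.finite_empty.subset (by rintro _ ⟨_, ⟨⟩, _⟩)
  | bot => exact Set.finite_empty.subset (by rintro _ ⟨_, ⟨⟩, _⟩)
  | disj => exact Set.finite_empty.subset (by rintro _ ⟨_, ⟨⟩, _⟩)
  | pre α x _ =>
    refine (Set.finite_singleton (cls x)).subset ?_
    rintro _ ⟨_, ⟨⟩, rfl⟩
    rfl
  | box x y hx hy => exact (hx.union hy).subset (actSucc_box_subset x y a)
  | conj x y hx hy => rw [actSucc_conj]; exact hx.image2 _ hy
  | par A x y hx hy =>
    by_cases ha : a ∈ A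
    · rw [actSucc_par_of_mem ha]; exact hx.image2 _ hy
    · exact ((hx.image2 _ (Set.finite_singleton _)).union
        ((Set.finite_singleton _).image2 _ hy)).subset (actSucc_par_subset ha x y)

/-! ### Unstable processes as joins of their τ-successors -/

/-- A τ-step of a composite moves one component. A stable component is not the join of its empty set
of successors, so `hp` and `hq` are conditional; distributing over one moving side already gives
minimality. -/
theorem Cls.JoinOp.isLUB_union {op : Cls Act → Cls Act → Cls Act} (h : Cls.JoinOp op)
    {X Y : Set (Cls Act)} (hX : X.Finite) (hY : Y.Finite) {p q : Cls Act}
    (hp : X.Nonempty → IsLUB X p) (hq : Y.Nonempty → IsLUB Y q)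
    (hne : X.Nonempty ∨ Y.Nonempty) :
    IsLUB ((fun r => op r q) '' X ∪ (fun r => op p r) '' Y) (op p q) := by
  constructor
  · rintro _ (⟨x, hx, rfl⟩ | ⟨y, hy, rfl⟩)
    · exact h.mono ((hp ⟨x, hx⟩).1 hx) le_rfl
    · exact h.mono le_rfl ((hq ⟨y, hy⟩).1 hy)
  · intro u hu
    rcases hne with hne | hne
    · rw [h.comm]
      refine h.le_of_isLUB hX (hp hne) fun x hx => ?_
      rw [h.comm]
      exact hu (Or.inl ⟨x, hx, rfl⟩)
    · exact h.le_of_isLUB hY (hq hne) fun y hy => hu (Or.inr ⟨y, hy, rfl⟩)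

theorem isLUB_tauSucc {t : Proc Act} (h : ¬ TauFree t) : IsLUB (tauSucc t) (cls t) := by
  rw [← tauSucc_nonempty] at h
  induction t with
  | nil => obtain ⟨_, _, ⟨⟩, _⟩ := h
  | bot => obtain ⟨_, _, ⟨⟩, _⟩ := h
  | pre α x _ =>
    cases α with
    | none => rw [tauSucc_tau, Cls.cls_tau]; exact isLUB_singleton
    | some a => obtain ⟨_, _, ⟨⟩, _⟩ := h
  | disj x y _ _ => rw [tauSucc_disj, Cls.cls_disj]; exact isLUB_pair
  | box x y hx hy =>
    rw [tauSucc_box] at h ⊢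
    exact Cls.joinOp_add.isLUB_union (finite_tauSucc x) (finite_tauSucc y) hx hy
      (by simpa using h)
  | conj x y hx hy =>
    rw [tauSucc_conj] at h ⊢
    exact Cls.joinOp_conj.isLUB_union (finite_tauSucc x) (finite_tauSucc y) hx hy
      (by simpa using h)
  | par A x y hx hy =>
    rw [tauSucc_par] at h ⊢
    exact (Cls.joinOp_par A).isLUB_union (finite_tauSucc x) (finite_tauSucc y) hx hy
      (by simpa using h)

theorem TauStep.cls_le {x y : Proc Act} (h : TauStep x y) : cls y ≤ cls x :=
  (isLUB_tauSucc fun hx => hx ⟨y, h⟩).1 h.mem_tauSucc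

theorem cls_le_of_reflTransGen {x y : Proc Act} (h : Relation.ReflTransGen TauStep x y) :
    cls y ≤ cls x := by
  induction h with
  | refl => rfl
  | tail _ h ih => exact h.cls_le.trans ih

/-! ### Inconsistency -/

theorem incon_pre {α : Option Act} {x : Proc Act} : Incon (pre α x) ↔ Incon x :=
  ⟨fun h => by cases h; assumption, .pre α⟩

theorem incon_box {x y : Proc Act} : Incon (box x y) ↔ Incon x ∨ Incon y :=
  ⟨fun h => by cases h <;> simp [*], fun h => h.elim .boxL .boxR⟩

theorem incon_par {A : Set Act} {x y : Proc Act} : Incon (par A x y) ↔ Incon x ∨ Incon y :=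
  ⟨fun h => by cases h <;> simp [*], fun h => h.elim .parL .parR⟩

/-- For the rule on stable derivatives: those of a τ-successor are among those of the source, and
the successor is again a conjunction. -/
theorem Incon.tauStep {x y : Proc Act} (hx : Incon x) (h : TauStep x y) : Incon y := by
  induction hx generalizing y with
  | bot => cases h
  | pre α hx _ => cases h; exact hx
  | disj h₁ h₂ _ _ => cases h <;> assumption
  | boxL h₁ ih => cases h with
    | boxL h => exact .boxL (ih h)
    | boxR h => exact .boxL h₁
  | boxR h₁ ih => cases h with
    | boxL h => exact .boxR h₁
    | boxR h => exact .boxR (ih h)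
  | parL h₁ ih => cases h with
    | parL h => exact .parL (ih h)
    | parR h => exact .parL h₁
  | parR h₁ ih => cases h with
    | parL h => exact .parR h₁
    | parR h => exact .parR (ih h)
  | conjL h₁ ih => cases h with
    | conjL h => exact .conjL (ih h)
    | conjR h => exact .conjL h₁
  | conjR h₁ ih => cases h with
    | conjL h => exact .conjR h₁
    | conjR h => exact .conjR (ih h)
  | readyL _ _ hs => exact absurd ⟨y, h⟩ hs
  | readyR _ _ hs => exact absurd ⟨y, h⟩ hs
  | @conjStep α x₁ x₂ z hz hall _ =>
    cases α with
    | none => exact hall y h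
    | some a => exact absurd ⟨y, h⟩ (ActStep.tauFree hz)
  | conjStable hall _ =>
    have key : ∀ z, StableDeriv y z → Incon z := fun z hz => hall z ⟨.head h hz.1, hz.2⟩
    cases h with
    | conjL h => exact .conjStable key
    | conjR h => exact .conjStable key

theorem Incon.reflTransGen {x y : Proc Act} (hx : Incon x)
    (h : Relation.ReflTransGen TauStep x y) : Incon y := by
  induction h with
  | refl => exact hx
  | tail _ h ih => exact ih.tauStep h

/-- For a conjunction this is the contrapositive of `conjStep` at τ; the other operators reduce to
their components. -/
theorem exists_consistent_tauStep {t : Proc Act} (ht : ¬ Incon t) (h : ¬ TauFree t) :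
    ∃ y, TauStep t y ∧ ¬ Incon y := by
  induction t with
  | nil => exact absurd tauFree_nil h
  | bot => exact absurd .bot ht
  | pre α x _ =>
    cases α with
    | none => exact ⟨x, .pre x, mt (.pre _) ht⟩
    | some a => exact absurd (tauFree_pre a x) h
  | disj x y _ _ =>
    by_cases hx : Incon x
    · exact ⟨y, .disjR x y, fun hy => ht (.disj hx hy)⟩
    · exact ⟨x, .disjL x y, hx⟩
  | box x y ihx ihy =>
    rw [incon_box, not_or] at ht
    by_cases hx : TauFree x
    · obtain ⟨z, hz, hc⟩ := ihy ht.2 fun hy => h (tauFree_box.2 ⟨hx, hy⟩)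
      exact ⟨_, .boxR hz, by simp [incon_box, ht.1, hc]⟩
    · obtain ⟨z, hz, hc⟩ := ihx ht.1 hx
      exact ⟨_, .boxL hz, by simp [incon_box, ht.2, hc]⟩
  | conj x y _ _ =>
    by_contra! hall
    obtain ⟨z, hz⟩ := not_not.1 h
    exact ht (.conjStep (α := none) hz hall)
  | par A x y ihx ihy =>
    rw [incon_par, not_or] at ht
    by_cases hx : TauFree x
    · obtain ⟨z, hz, hc⟩ := ihy ht.2 fun hy => h (tauFree_par.2 ⟨hx, hy⟩)
      exact ⟨_, .parR hz, by simp [incon_par, ht.1, hc]⟩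
    · obtain ⟨z, hz, hc⟩ := ihx ht.1 hx
      exact ⟨_, .parL hz, by simp [incon_par, ht.2, hc]⟩

theorem incon_conj_of_tauFree {x y : Proc Act} (h : Incon (conj x y))
    (hs : TauFree (conj x y)) :
    Incon x ∨ Incon y ∨ (∃ a, ¬ ((∃ z, ActStep x a z) ↔ ∃ z, ActStep y a z)) ∨
      ∃ a, (∃ z, ActStep (conj x y) a z) ∧ ∀ z, ActStep (conj x y) a z → Incon z := by
  generalize ht : conj x y = t at h hs
  induction h with
  | conjL h => cases ht; exact .inl h
  | conjR h => cases ht; exact .inr (.inl h)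
  | readyL h h' => cases ht; exact .inr (.inr (.inl ⟨_, fun hi => h' (hi.1 ⟨_, h⟩)⟩))
  | readyR h h' => cases ht; exact .inr (.inr (.inl ⟨_, fun hi => h (hi.2 ⟨_, h'⟩)⟩))
  | @conjStep α _ _ z hz hall _ =>
    cases ht
    cases α with
    | none => exact absurd ⟨z, hz⟩ hs
    | some a => exact .inr (.inr (.inr ⟨a, ⟨z, hz⟩, hall⟩))
  -- A stable process is its own stable derivative, so this rule only hands back a shorter
  -- derivation of the same fact.
  | conjStable _ ih => exact ih _ ⟨.refl, hs⟩ ht hs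
  | _ => cases ht

/-! ### Head normal forms -/

/-- Provably, `p` is `□_{a ∈ S} a.(f a)`, where `S` is the ready set of `p` and `f a` is the join
of the `a`-successors. -/
structure HeadForm (p : Proc Act) (S : Finset Act) (f : Act → Cls Act) : Prop where
  eq : cls p = ∑ a ∈ S, Cls.pre a (f a)
  mem : ∀ a, a ∈ S ↔ ∃ x, ActStep p a x
  lub : ∀ a, IsLUB (actSucc p a) (f a)
  basic : ∀ a ∈ S, Cls.IsB (f a)

theorem HeadForm.eq_bot {p : Proc Act} {S : Finset Act} {f : Act → Cls Act}
    (h : HeadForm p S f) {a : Act} (ha : a ∉ S) : f a = ⊥ := by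
  have h₁ : actSucc p a = ∅ := by
    rw [actSucc, Set.image_eq_empty, Set.eq_empty_iff_forall_notMem]
    exact fun x hx => ha ((h.mem a).2 ⟨x, hx⟩)
  have h₂ := h.lub a
  rw [h₁] at h₂
  exact h₂.unique isLUB_empty

/-- Inconsistent processes are provably `⊥`; consistent ones are provably basic and, if stable,
have a head normal form. -/
structure Reducible (t : Proc Act) : Prop where
  eq_bot : Incon t → cls t = ⊥
  isB : ¬ Incon t → Cls.IsB (cls t)
  headForm : ¬ Incon t → TauFree t → ∃ S f, HeadForm t S f

theorem Reducible.eq_bot_or_isB {t : Proc Act} (h : Reducible t) :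
    cls t = ⊥ ∨ Cls.IsB (cls t) :=
  (em (Incon t)).imp h.eq_bot h.isB

theorem Reducible.of_headForm {t : Proc Act} (h : Incon t → cls t = ⊥)
    (h' : ¬ Incon t → ∃ S f, HeadForm t S f) : Reducible t where
  eq_bot := h
  isB ht := by
    obtain ⟨S, f, hf⟩ := h' ht
    rw [hf.eq]
    exact Cls.isB_sum _ _ fun a ha => (hf.basic a ha).pre a
  headForm ht _ := h' ht

/-- Inconsistency passes to all τ-successors, making the join ⊥; consistency passes to at least one,
making the join basic. -/
theorem Reducible.of_tauStep {t : Proc Act} (ht : ¬ TauFree t)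
    (h : ∀ y, TauStep t y → Reducible y) : Reducible t where
  eq_bot hi := by
    refine le_bot_iff.1 ((isLUB_tauSucc ht).2 ?_)
    rintro _ ⟨y, hy, rfl⟩
    exact ((h y hy).eq_bot (hi.tauStep hy)).le
  isB hi := by
    refine Cls.isB_of_isLUB (finite_tauSucc t) ?_ ?_ (isLUB_tauSucc ht)
    · rintro _ ⟨y, hy, rfl⟩
      exact (h y hy).eq_bot_or_isB
    · obtain ⟨y, hy, hc⟩ := exists_consistent_tauStep hi ht
      exact ⟨_, hy.mem_tauSucc, (h y hy).isB hc⟩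
  headForm _ hs := absurd hs ht

/-! ### Reducibility operator by operator -/

theorem reducible_nil : Reducible (nil : Proc Act) := by
  refine .of_headForm (fun h => by cases h) fun _ => ⟨∅, fun _ => ⊥, ?_, ?_, ?_, ?_⟩
  · simp [Cls.cls_nil]
  · intro a
    simp only [Finset.notMem_empty, false_iff]
    rintro ⟨_, ⟨⟩⟩
  · intro a
    rw [actSucc_nil]
    exact isLUB_empty
  · simp

theorem reducible_bot : Reducible (bot : Proc Act) :=
  .of_headForm (fun _ => rfl) fun h => absurd .bot h

theorem Reducible.pre (a : Act) {x : Proc Act} (h : Reducible x) :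
    Reducible (pre (some a) x) := by
  classical
  refine .of_headForm (fun hi => ?_) fun hc =>
    ⟨{a}, fun b => if b = a then cls x else ⊥, ?_, ?_, ?_, ?_⟩
  · rw [Cls.cls_pre, h.eq_bot (incon_pre.1 hi), Cls.pre_bot]
  · simp [Cls.cls_pre]
  · intro b
    rw [Finset.mem_singleton]
    constructor
    · rintro rfl; exact ⟨_, .pre b x⟩
    · rintro ⟨_, ⟨⟩⟩; rfl
  · intro b
    by_cases hb : b = a
    · subst hb
      rw [actSucc_pre_self, if_pos rfl]
      exact isLUB_singleton
    · rw [actSucc_pre_of_ne hb, if_neg hb]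
      exact isLUB_empty
  · simpa using h.isB (mt incon_pre.2 hc)

theorem Cls.isB_sup_of_mem {S T : Finset Act} {f g : Act → Cls Act}
    (hf : ∀ a ∈ S, IsB (f a)) (hf0 : ∀ a ∉ S, f a = ⊥)
    (hg : ∀ a ∈ T, IsB (g a)) (hg0 : ∀ a ∉ T, g a = ⊥) {a : Act} (h : a ∈ S ∨ a ∈ T) :
    IsB (f a ⊔ g a) := by
  by_cases hS : a ∈ S
  · by_cases hT : a ∈ T
    · exact (hf a hS).sup (hg a hT)
    · rw [hg0 a hT, sup_bot_eq]; exact hf a hS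
  · rw [hf0 a hS, bot_sup_eq]; exact hg a (h.resolve_left hS)

theorem Reducible.box {x y : Proc Act} (hs : TauFree (box x y)) (hx : Reducible x)
    (hy : Reducible y) : Reducible (box x y) := by
  classical
  refine .of_headForm (fun hi => ?_) fun hc => ?_
  · rw [Cls.cls_box]
    rcases incon_box.1 hi with h | h
    · rw [hx.eq_bot h, Cls.bot_add]
    · rw [hy.eq_bot h, Cls.add_bot]
  · rw [incon_box, not_or] at hc
    obtain ⟨S, f, hf⟩ := hx.headForm hc.1 (tauFree_box.1 hs).1
    obtain ⟨T, g, hg⟩ := hy.headForm hc.2 (tauFree_box.1 hs).2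
    refine ⟨S ∪ T, fun a => f a ⊔ g a, ?_, fun a => ?_, fun a => ?_, fun a ha => ?_⟩
    · rw [Cls.cls_box, hf.eq, hg.eq, Cls.sum_pre_add_sum_pre hf.basic (fun _ => hf.eq_bot)
        hg.basic fun _ => hg.eq_bot]
    · rw [Finset.mem_union, hf.mem, hg.mem]
      have h := tauFree_box.1 hs
      constructor
      · rintro (⟨z, hz⟩ | ⟨z, hz⟩)
        exacts [⟨z, .boxL hz h.2⟩, ⟨z, .boxR h.1 hz⟩]
      · rintro ⟨z, hz | hz⟩
        exacts [Or.inl ⟨z, ‹_›⟩, Or.inr ⟨z, ‹_›⟩]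
    · rw [actSucc_box hs]
      exact (hf.lub a).union (hg.lub a)
    · exact Cls.isB_sup_of_mem hf.basic (fun _ => hf.eq_bot) hg.basic (fun _ => hg.eq_bot)
        (Finset.mem_union.1 ha)

/-- The a-successors are conjunctions that need not be subterms, hence the hypothesis `hz`. It
decides whether a coefficient is ⊥ or basic. -/
theorem Reducible.conj {x y : Proc Act} (hs : TauFree (conj x y)) (hx : Reducible x)
    (hy : Reducible y) (hz : ∀ a z, ActStep (conj x y) a z → Reducible z) :
    Reducible (conj x y) := by
  classical
  have lub : ∀ {S T f g}, HeadForm x S f → HeadForm y T g → ∀ a,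
      IsLUB (actSucc (Proc.conj x y) a) (Cls.conj (f a) (g a)) := by
    intro S T f g hf hg a
    rw [actSucc_conj]
    exact Cls.joinOp_conj.isLUB_image2 (finite_actSucc x a) (finite_actSucc y a) (hf.lub a)
      (hg.lub a)
  by_cases hix : Incon x
  · refine .of_headForm (fun _ => ?_) fun h => absurd (.conjL hix) h
    rw [Cls.cls_conj, hx.eq_bot hix, Cls.joinOp_conj.bot_left]
  by_cases hiy : Incon y
  · refine .of_headForm (fun _ => ?_) fun h => absurd (.conjR hiy) h
    rw [Cls.cls_conj, hy.eq_bot hiy, Cls.joinOp_conj.bot]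
  obtain ⟨S, f, hf⟩ := hx.headForm hix (tauFree_conj.1 hs).1
  obtain ⟨T, g, hg⟩ := hy.headForm hiy (tauFree_conj.1 hs).2
  by_cases hST : S = T
  · subst hST
    have eq : cls (Proc.conj x y) = ∑ a ∈ S, Cls.pre a (Cls.conj (f a) (g a)) := by
      rw [Cls.cls_conj, hf.eq, hg.eq, Cls.conj_sum_pre]
    have mem : ∀ a, a ∈ S ↔ ∃ z, ActStep (Proc.conj x y) a z := by
      intro a
      constructor
      · intro ha
        obtain ⟨z, hz⟩ := (hf.mem a).1 ha
        obtain ⟨w, hw⟩ := (hg.mem a).1 ha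
        exact ⟨_, .conj hz hw⟩
      · rintro ⟨_, h⟩
        cases h with
        | conj h _ => exact (hf.mem a).2 ⟨_, h⟩
    refine .of_headForm (fun hi => ?_) fun hc => ⟨S, _, eq, mem, lub hf hg, fun a ha => ?_⟩
    · rcases incon_conj_of_tauFree hi hs with h | h | ⟨a, h⟩ | ⟨a, ha, hall⟩
      · exact absurd h hix
      · exact absurd h hiy
      · exact absurd ((hf.mem a).symm.trans (hg.mem a)) h
      · have h : Cls.conj (f a) (g a) = ⊥ := by
          refine le_bot_iff.1 ((lub hf hg a).2 ?_)
          rintro _ ⟨z, h, rfl⟩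
          exact ((hz a z h).eq_bot (hall z h)).le
        -- A single summand equal to ⊥ absorbs the entire sum.
        rw [eq, ← Finset.add_sum_erase _ _ ((mem a).2 ha), h, Cls.pre_bot, Cls.bot_add]
    · refine Cls.isB_of_isLUB (finite_actSucc _ a) ?_ ?_ (lub hf hg a)
      · rintro _ ⟨z, h, rfl⟩
        exact (hz a z h).eq_bot_or_isB
      · obtain ⟨z, h⟩ := (mem a).1 ha
        by_contra! hall
        -- If no a-successor were basic, all would be inconsistent, and so would the conjunction.
        exact hc (.conjStep (α := some a) h fun w hw => by_contra fun hn =>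
          hall _ (ActStep.mem_actSucc hw) ((hz a w hw).isB hn))
  · refine .of_headForm (fun _ => ?_) fun hc => absurd (Finset.ext fun a => ?_) hST
    · rw [Cls.cls_conj, hf.eq, hg.eq, Cls.conj_sum_pre_of_ne hST]
    · rw [hf.mem, hg.mem]
      by_contra hn
      by_cases h : ∃ z, ActStep x a z
      · obtain ⟨z, hz⟩ := h
        exact hc (.readyL hz (fun h' => hn (iff_of_true ⟨z, hz⟩ h')) hs)
      · by_cases h' : ∃ z, ActStep y a z
        · exact hc (.readyR h h'.choose_spec hs)
        · exact hn (iff_of_false h h')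

theorem Reducible.par {A : Set Act} {x y : Proc Act} (hs : TauFree (par A x y))
    (hx : Reducible x) (hy : Reducible y) : Reducible (par A x y) := by
  classical
  refine .of_headForm (fun hi => ?_) fun hc => ?_
  · rw [Cls.cls_par]
    rcases incon_par.1 hi with h | h
    · rw [hx.eq_bot h, (Cls.joinOp_par A).bot_left]
    · rw [hy.eq_bot h, (Cls.joinOp_par A).bot]
  rw [incon_par, not_or] at hc
  have hs' := tauFree_par.1 hs
  obtain ⟨S, f, hf⟩ := hx.headForm hc.1 hs'.1
  obtain ⟨T, g, hg⟩ := hy.headForm hc.2 hs'.2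
  have bx := hx.isB hc.1
  have bY := hy.isB hc.2
  -- Coefficients of left moves, right moves and synchronisations; the value ⊥ where a rule does not
  -- apply leaves their join unchanged.
  set f₁ : Act → Cls Act := fun a => if a ∈ A then ⊥ else Cls.par A (f a) (cls y) with hf₁
  set f₂ : Act → Cls Act := fun a => if a ∈ A then ⊥ else Cls.par A (cls x) (g a) with hf₂
  set f₃ : Act → Cls Act := fun a => if a ∈ A then Cls.par A (f a) (g a) else ⊥ with hf₃
  set S₁ := S.filter (· ∉ A) with hS₁
  set S₂ := T.filter (· ∉ A) with hS₂
  set S₃ := (S ∩ T).filter (· ∈ A) with hS₃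
  have b₁ : ∀ a ∈ S₁, Cls.IsB (f₁ a) := by
    intro a ha
    rw [hS₁, Finset.mem_filter] at ha
    simpa [hf₁, ha.2] using (hf.basic a ha.1).par A bY
  have b₂ : ∀ a ∈ S₂, Cls.IsB (f₂ a) := by
    intro a ha
    rw [hS₂, Finset.mem_filter] at ha
    simpa [hf₂, ha.2] using bx.par A (hg.basic a ha.1)
  have b₃ : ∀ a ∈ S₃, Cls.IsB (f₃ a) := by
    intro a ha
    rw [hS₃, Finset.mem_filter, Finset.mem_inter] at ha
    simpa [hf₃, ha.2] using (hf.basic a ha.1.1).par A (hg.basic a ha.1.2)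
  have z₁ : ∀ a ∉ S₁, f₁ a = ⊥ := by
    intro a ha
    by_cases hA : a ∈ A
    · simp [hf₁, hA]
    · have : a ∉ S := by simpa [hS₁, hA] using ha
      simp [hf₁, hf.eq_bot this, (Cls.joinOp_par A).bot_left]
  have z₂ : ∀ a ∉ S₂, f₂ a = ⊥ := by
    intro a ha
    by_cases hA : a ∈ A
    · simp [hf₂, hA]
    · have : a ∉ T := by simpa [hS₂, hA] using ha
      simp [hf₂, hg.eq_bot this, (Cls.joinOp_par A).bot]
  have z₃ : ∀ a ∉ S₃, f₃ a = ⊥ := by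
    intro a ha
    by_cases hA : a ∈ A
    · by_cases hS : a ∈ S
      · have : a ∉ T := by simpa [hS₃, hA, hS] using ha
        simp [hf₃, hg.eq_bot this, (Cls.joinOp_par A).bot]
      · simp [hf₃, hf.eq_bot hS, (Cls.joinOp_par A).bot_left]
    · simp [hf₃, hA]
  have b₁₂ : ∀ a ∈ S₁ ∪ S₂, Cls.IsB (f₁ a ⊔ f₂ a) := fun a ha =>
    Cls.isB_sup_of_mem b₁ z₁ b₂ z₂ (Finset.mem_union.1 ha)
  have z₁₂ : ∀ a ∉ S₁ ∪ S₂, f₁ a ⊔ f₂ a = ⊥ := by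
    intro a ha
    rw [Finset.mem_union, not_or] at ha
    rw [z₁ a ha.1, z₂ a ha.2, sup_idem]
  refine ⟨S₁ ∪ S₂ ∪ S₃, fun a => (f₁ a ⊔ f₂ a) ⊔ f₃ a, ?_, fun a => ?_, fun a => ?_,
    fun a ha => ?_⟩
  · rw [← Cls.sum_pre_add_sum_pre b₁₂ z₁₂ b₃ z₃, ← Cls.sum_pre_add_sum_pre b₁ z₁ b₂ z₂,
      Cls.cls_par]
    -- After expansion, the idle components are folded back from sums to `cls x` and `cls y`.
    conv_lhs => rw [hf.eq, hg.eq, Cls.par_sum_pre A hf.basic hg.basic, ← hf.eq, ← hg.eq]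
    congr 1
    · congr 1
      · refine Finset.sum_congr rfl fun a ha => ?_
        simp [hf₁, (Finset.mem_filter.1 ha).2]
      · refine Finset.sum_congr rfl fun a ha => ?_
        simp [hf₂, (Finset.mem_filter.1 ha).2]
    · refine Finset.sum_congr rfl fun a ha => ?_
      simp [hf₃, (Finset.mem_filter.1 ha).2]
  · simp only [hS₁, hS₂, hS₃, Finset.mem_union, Finset.mem_filter, Finset.mem_inter, hf.mem,
      hg.mem]
    constructor
    · rintro ((⟨⟨z, hz⟩, hA⟩ | ⟨⟨z, hz⟩, hA⟩) | ⟨⟨⟨z, hz⟩, ⟨w, hw⟩⟩, hA⟩)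
      exacts [⟨_, .parL hA hz hs'.2⟩, ⟨_, .parR hA hs'.1 hz⟩, ⟨_, .parSync hA hz hw⟩]
    · rintro ⟨_, h⟩
      cases h with
      | parL hA hz _ => exact .inl (.inl ⟨⟨_, hz⟩, hA⟩)
      | parR hA _ hz => exact .inl (.inr ⟨⟨_, hz⟩, hA⟩)
      | parSync hA hz hw => exact .inr ⟨⟨⟨_, hz⟩, ⟨_, hw⟩⟩, hA⟩
  · by_cases hA : a ∈ A
    · rw [actSucc_par_of_mem hA]
      simpa [hf₁, hf₂, hf₃, hA] using (Cls.joinOp_par A).isLUB_image2 (finite_actSucc x a)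
        (finite_actSucc y a) (hf.lub a) (hg.lub a)
    · rw [actSucc_par_of_notMem hA hs]
      have h₁ := (Cls.joinOp_par A).isLUB_image2 (finite_actSucc x a)
        (Set.finite_singleton (cls y)) (hf.lub a) isLUB_singleton
      have h₂ := (Cls.joinOp_par A).isLUB_image2 (Set.finite_singleton (cls x))
        (finite_actSucc y a) isLUB_singleton (hg.lub a)
      simp only [hf₁, hf₂, hf₃, hA, if_false, sup_bot_eq]
      exact h₁.union h₂
  · exact Cls.isB_sup_of_mem b₁₂ z₁₂ b₃ z₃ (Finset.mem_union.1 ha)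

theorem reducible (t : Proc Act) : Reducible t := by
  induction hn : size t using Nat.strong_induction_on generalizing t with
  | _ n ih =>
    subst hn
    by_cases hs : TauFree t
    · cases t with
      | nil => exact reducible_nil
      | bot => exact reducible_bot
      | pre α x =>
        cases α with
        | none => exact absurd hs (not_tauFree_tau x)
        | some a => exact (ih _ (by simp only [size]; omega) x rfl).pre a
      | disj x y => exact absurd hs (not_tauFree_disj x y)
      | box x y =>
        exact .box hs (ih _ (by simp only [size]; omega) x rfl)
          (ih _ (by simp only [size]; omega) y rfl)
      | conj x y =>
        exact .conj hs (ih _ (by simp only [size]; omega) x rfl)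
          (ih _ (by simp only [size]; omega) y rfl) fun a z h => ih _ h.size_lt z rfl
      | par A x y =>
        exact .par hs (ih _ (by simp only [size]; omega) x rfl)
          (ih _ (by simp only [size]; omega) y rfl)
    · exact .of_tauStep hs fun y h => ih _ h.size_lt y rfl

/-! ### Completeness -/

/-- Unfolding joins along τ-steps ends in stable derivatives, and the inconsistent ones contribute
⊥. -/
theorem cls_le_of_stableDeriv {t : Proc Act} {u : Cls Act}
    (h : ∀ p, StableDeriv t p → ¬ Incon p → cls p ≤ u) : cls t ≤ u := by
  induction hn : size t using Nat.strong_induction_on generalizing t with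
  | _ n ih =>
    subst hn
    by_cases hi : Incon t
    · rw [(reducible t).eq_bot hi]
      exact bot_le
    by_cases hs : TauFree t
    · exact h t ⟨.refl, hs⟩ hi
    · refine (isLUB_tauSucc hs).2 ?_
      rintro _ ⟨y, hy, rfl⟩
      exact ih _ (TauStep.size_lt hy) (fun p hp => h p ⟨.head hy hp.1, hp.2⟩) rfl

/-- Since inconsistency persists along τ-steps, a consistent endpoint makes the whole path
consistent. -/
theorem epsF_of_reflTransGen {x y : Proc Act} (h : Relation.ReflTransGen TauStep x y)
    (hy : ¬ Incon y) : (lts Act).epsF x y := by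
  refine ⟨fun hx : Incon x => hy (hx.reflTransGen h), ?_⟩
  induction h with
  | refl => exact .refl
  | tail _ h ih =>
    have hb := mt (fun hi => Incon.tauStep hi h) hy
    exact (ih hb).tail ⟨h, hb, hy⟩

theorem reflTransGen_of_epsF {x y : Proc Act} (h : (lts Act).epsF x y) :
    Relation.ReflTransGen TauStep x y :=
  h.2.lift id fun _ _ h => h.1

theorem cls_le_of_isStableReadySim {R : Proc Act → Proc Act → Prop}
    (hR : (lts Act).IsStableReadySim R) {p q : Proc Act} (hpq : R p q) : cls p ≤ cls q := by
  induction hn : size p using Nat.strong_induction_on generalizing p q with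
  | _ n ih =>
    subst hn
    by_cases hp : Incon p
    · rw [(reducible p).eq_bot hp]
      exact bot_le
    have hq : ¬ Incon q := hR.consistent p q hpq hp
    obtain ⟨sp, sq⟩ : TauFree p ∧ TauFree q := hR.stable p q hpq
    obtain ⟨S, f, hf⟩ := (reducible p).headForm hp sp
    obtain ⟨T, g, hg⟩ := (reducible q).headForm hq sq
    have hST : S = T := by
      ext a
      rw [hf.mem, hg.mem]
      exact Set.ext_iff.1 (hR.ready p q hpq hp) (some a)
    subst hST
    rw [hf.eq, hg.eq]
    -- With equal ready sets, it remains to bound each a-successor of p by the coefficient `g a`.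
    refine Finset.sum_le_sum fun a _ => Cls.pre_mono a ((hf.lub a).2 ?_)
    rintro _ ⟨x, hx, rfl⟩
    refine cls_le_of_stableDeriv fun p' hp' hc => ?_
    have hxc : ¬ Incon x := fun h => hc (h.reflTransGen hp'.1)
    obtain ⟨q', ⟨⟨r, s, hqr, ⟨hrs, -⟩, hsq⟩, -⟩, hR'⟩ := hR.sim p q hpq a p'
      ⟨⟨p, x, ⟨hp, .refl⟩, ⟨hx, hp, hxc⟩, epsF_of_reflTransGen hp'.1 hc⟩, hp'.2⟩
    -- As q is stable, its matching weak transition begins with the a-step itself.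
    have hqr' : q = r := by
      rcases (reflTransGen_of_epsF hqr).cases_head with h | ⟨z, hz, -⟩
      · exact h
      · exact absurd ⟨z, hz⟩ sq
    subst hqr'
    -- The chain is p' ≤ q' ≤ s ≤ `g a`: induction on the smaller p', then τ-steps descend in the
    -- order, then s is an a-successor of q.
    exact (ih _ ((size_le_of_reflTransGen hp'.1).trans_lt (ActStep.size_lt hx)) hR' rfl).trans
      ((cls_le_of_reflTransGen (reflTransGen_of_epsF hsq)).trans ((hg.lub a).1 (ActStep.mem_actSucc hrs)))

theorem cls_le_of_readySim {t₁ t₂ : Proc Act} (h : (lts Act).ReadySim t₁ t₂) :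
    cls t₁ ≤ cls t₂ := by
  refine cls_le_of_stableDeriv fun p hp hc => ?_
  obtain ⟨q, ⟨hq, -⟩, R, hR, hpq⟩ :=
    h p ⟨epsF_of_reflTransGen hp.1 hc, hp.2⟩
  exact (cls_le_of_isStableReadySim hR hpq).trans (cls_le_of_reflTransGen (reflTransGen_of_epsF hq))

end CLL

theorem mainTheorem1 {Act : Type*} (t₁ t₂ : CLL.Proc Act)
    (h : (CLL.lts Act).ReadySim t₁ t₂) :
    CLL.Deriv t₁ t₂ ∧ CLL.DerivPrefixIdem t₁ t₂ := by
  have h' : CLL.DerivPrefixIdem t₁ t₂ := CLL.cls_le.1 (CLL.cls_le_of_readySim h)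
  exact ⟨CLL.DerivWith.mono (Set.subset_univ _) h', h'⟩
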